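/- Let $\mathcal P$ be a commutative ring with identity $1\neq 0$ (for instance a principal ideal domain). Let $G$ be a finite loopless signed multidigraph, with $m_{uw}$ arcs from $u$ to $w$, all of the same sign $\sigma(uw)\in\{1,-1\}$. Its generalized Laplacian $L(G,X)$ is the matrix over $\mathcal P[x_u : u\in V(G)]$ with diagonal entries $x_u$ and entries $-\sigma(uw)m_{uw}$ for $u\neq w$. Its $i$-th critical ideal $I_i(G,X)$ is the ideal generated by the $i\times i$ minors of $L(G,X)$ (so $I_0=\langle 1\rangle$, and $I_i=\langle 0\rangle$ for $i>|V(G)|$), and its algebraic co-rank $\gamma(G)$ is the largest $i$ with $I_i(G,X)=\langle 1\rangle$. For a vertex $v$ of $G$ and $K\ge 0$ let $d^K(G,v)$ be obtained from $G$ by duplicating $v$ a total of $K$ times, that is, by adding new vertices $v^1,\dots,v^K$ such that for each vertex $u\neq v$ of $G$ the arcs between $v^t$ and $u$, in both directions, agree in number and sign with those between $v$ and $u$, and such that there are no arcs among $v^0=v,v^1,\dots,v^K$; put $d(G,v)=d^1(G,v)$. Let $$P_l^K(v)=\Bigl\{\prod_{c\in C}x_{v^c} : C\subseteq\{0,\dots,K\},\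 |C|=l\Bigr\}.$$ Put $\gamma_d=\gamma(d(G,v))$, $\gamma_v=\gamma(G-v)$, and $\lambda=0$ if $\gamma_v=\gamma_d$, $\lambda=1$ otherwise. If $\gamma(G)\ge 2$, then $0\le\gamma_d-\gamma_v\le 2$, and for all integers $k\ge 1$ and $i\ge 0$ we have in the polynomial ring over $\mathcal P$ in the variables of $d^{k+\lambda+i}(G,v)$ $$I_{\gamma_d+k}\bigl(d^{k+\lambda+i}(G,v),X\bigr)=\Bigl\langle\, p\cdot f|_{x_v=0} \;:\; 0\le l\le k,\ p\in P_l^{k+\lambda+i}(v),\ f\in I_{\gamma_d+k-l}(G,X)\Bigr\rangle .$$ -/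

import Mathlib

open MvPolynomial

noncomputable section

/-- A loopless signed multidigraph on the vertex set `V`: `mult u w` is the number of arcs
from `u` to `w`, and `sign u w` is the common sign `1` or `-1` of these arcs (irrelevant when
`mult u w = 0`). -/
structure SignedMultidigraph (V : Type*) where
  mult : V → V → ℕ
  sign : V → V → ℤˣ
  loopless : ∀ u, mult u u = 0

namespace SignedMultidigraph

/-- The pull-back of a signed multidigraph along a map of vertex sets: the arcs from `p` to `q`
are copies of the arcs from `f p` to `f q`. -/
def comap {V W : Type*} (f : W → V) (G : SignedMultidigraph V) : SignedMultidigraph W where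
  mult p q := G.mult (f p) (f q)
  sign p q := G.sign (f p) (f q)
  loopless p := G.loopless (f p)

/-- The induced subgraph `G - v`. -/
def deleteVertex {V : Type*} (G : SignedMultidigraph V) (v : V) :
    SignedMultidigraph {u : V // u ≠ v} :=
  G.comap Subtype.val

/-- `d^k(G, v)`: the vertex `v` is duplicated `k` times. The vertices of `G` are `Sum.inl u`, and
the `k` new vertices `Sum.inr s` have exactly the arcs of `v`, with multiplicities and signs; as
`G` is loopless, there are no arcs among the copies of `v`. -/
def duplicate {V : Type*} (G : SignedMultidigraph V) (v : V) (k : ℕ) :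
    SignedMultidigraph (V ⊕ Fin k) :=
  G.comap (Sum.elim id (fun _ => v))

/-- The generalized Laplacian matrix `L(G, X)` over the polynomial ring `R[x_u : u ∈ V]`. -/
def laplacian {V : Type*} [DecidableEq V] (R : Type*) [CommRing R] (G : SignedMultidigraph V) :
    Matrix V V (MvPolynomial V R) :=
  Matrix.of fun u w =>
    if u = w then X u else -C (((G.sign u w : ℤ) : R) * ((G.mult u w : ℕ) : R))

/-- The `i`-th critical ideal `I_i(G, X)`, generated by the `i × i` minors of `L(G, X)`.
A submatrix is given by an enumeration of its `i` rows and of its `i` columns; the choice of the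
enumeration changes the minor only by a sign. So the ideal is `⊤` for `i = 0` and `⊥` for
`i > |V|`. -/
def criticalIdeal {V : Type*} [DecidableEq V] (R : Type*) [CommRing R] (G : SignedMultidigraph V)
    (i : ℕ) : Ideal (MvPolynomial V R) :=
  Ideal.span {p | ∃ r c : Fin i ↪ V, p = ((G.laplacian R).submatrix r c).det}

open Classical in
/-- The algebraic co-rank: the largest `i ≤ |V|` such that `I_i(G, X)` is trivial, i.e. equal to
the whole polynomial ring. -/
def corank {V : Type*} [Fintype V] [DecidableEq V] (R : Type*) [CommRing R]
    (G : SignedMultidigraph V) : ℕ :=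
  Nat.findGreatest (fun i => G.criticalIdeal R i = ⊤) (Fintype.card V)

end SignedMultidigraph

/-- The vertex `v^t` of `d^k(G, v)` for `t = 0, …, k`, with `v^0 = v`. -/
def twin {V : Type*} (v : V) (k : ℕ) : Fin (k + 1) → V ⊕ Fin k :=
  Fin.cases (Sum.inl v) Sum.inr

/-- `P_l^k(v)`: the products of `l` distinct variables among `x_{v^0}, …, x_{v^k}`. -/
def twinProducts {V : Type*} (R : Type*) [CommRing R] (v : V) (k l : ℕ) :
    Set (MvPolynomial (V ⊕ Fin k) R) :=
  {p | ∃ S : Finset (Fin (k + 1)), S.card = l ∧ p = ∏ t ∈ S, X (twin v k t)}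

/-- The evaluation `f ↦ f|_{x_v = 0}`. -/
def evalZero {V : Type*} [DecidableEq V] (R : Type*) [CommRing R] (v : V) :
    MvPolynomial V R →ₐ[R] MvPolynomial V R :=
  aeval fun u => if u = v then 0 else X u

/-- The constant `λ(r, s)`. -/
def regularityConst (r s : ℕ) : ℕ := if r = s then 0 else 1

end

/-!
Collapsing the copies of `v` writes `L(d^K(G, v))` as the diagonal matrix of the variables of the
copies plus a matrix whose rows and columns repeat those of `L(G)|_{x_v = 0}`; in the latter the
copies of `v` are indistinguishable and have zero diagonal entries. Expanding a `j × j` minor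
multilinearly along the rows of the copies gives a sum of terms in `P_l · I_{j-l}(G)|_{x_v = 0}`,
where `l` copies contribute their variable. Since `I_{γ_d}(G)|_{x_v = 0}` is trivial, the terms with
`l > k` are absorbed by the one with `l = k` when `j = γ_d + k`.

Conversely, take `l` copies `C` and a minor of `L(G)|_{x_v = 0}`. Bordering the minor by the
rows and columns of `C` yields a minor of `L(d^K(G, v))` whose top term is the product of the
variables of `C` with the given minor, and whose other terms involve fewer copies: this is an
induction on `l`. If the given minor uses the row and the column of `v`, two further copies are
needed to represent them off the diagonal. There are enough copies unless `l = k = K`, which happens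
only for `λ = 0`, and then it suffices to use minors of `L(G - v)`, as they generate the unit ideal.
-/

section DeterminantalIdeal

variable {m n S : Type*} [CommRing S]

/-- The determinantal ideal of a matrix: the ideal generated by its `i × i` minors, where a
submatrix is given by enumerations of its rows and columns as in `criticalIdeal`. -/
def determinantalIdeal (A : Matrix m n S) (i : ℕ) : Ideal S :=
  Ideal.span {p | ∃ (r : Fin i ↪ m) (c : Fin i ↪ n), p = (A.submatrix r c).det}

theorem det_submatrix_mem_determinantalIdeal {ι : Type*} [Fintype ι] [DecidableEq ι]
    (A : Matrix m n S) (r : ι → m) (c : ι → n) :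
    (A.submatrix r c).det ∈ determinantalIdeal A (Fintype.card ι) := by
  by_cases hr : Function.Injective r
  · by_cases hc : Function.Injective c
    · let e := (Fintype.equivFin ι).symm
      rw [← Matrix.det_submatrix_equiv_self e]
      exact Ideal.subset_span ⟨⟨r ∘ e, hr.comp e.injective⟩, ⟨c ∘ e, hc.comp e.injective⟩, rfl⟩
    · obtain ⟨a, b, hab, hne⟩ := Function.not_injective_iff.mp hc
      rw [Matrix.det_zero_of_column_eq hne fun k => by simp [hab]]
      exact zero_mem _
  · obtain ⟨a, b, hab, hne⟩ := Function.not_injective_iff.mp hr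
    rw [Matrix.det_zero_of_row_eq hne (by ext k; simp [hab])]
    exact zero_mem _

theorem determinantalIdeal_le_iff {A : Matrix m n S} {i : ℕ} {J : Ideal S} :
    determinantalIdeal A i ≤ J ↔
      ∀ (r : Fin i ↪ m) (c : Fin i ↪ n), (A.submatrix r c).det ∈ J := by
  refine Ideal.span_le.trans ⟨fun h r c => h ⟨r, c, rfl⟩, ?_⟩
  rintro h _ ⟨r, c, rfl⟩
  exact h r c

theorem determinantalIdeal_zero (A : Matrix m n S) : determinantalIdeal A 0 = ⊤ := by
  rw [Ideal.eq_top_iff_one, ← Fintype.card_fin 0]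
  simpa using det_submatrix_mem_determinantalIdeal A Fin.elim0 Fin.elim0

theorem determinantalIdeal_submatrix_le {m' n' : Type*} (A : Matrix m n S) (f : m' → m)
    (g : n' → n) (i : ℕ) : determinantalIdeal (A.submatrix f g) i ≤ determinantalIdeal A i :=
  determinantalIdeal_le_iff.mpr fun r c => by
    simpa using det_submatrix_mem_determinantalIdeal A (f ∘ r) (g ∘ c)

theorem determinantalIdeal_transpose_le (A : Matrix m n S) (i : ℕ) :
    determinantalIdeal A.transpose i ≤ determinantalIdeal A i :=
  determinantalIdeal_le_iff.mpr fun r c => by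
    rw [← Matrix.det_transpose]
    exact Ideal.subset_span ⟨c, r, rfl⟩

theorem map_determinantalIdeal {S' F : Type*} [CommRing S'] [FunLike F S S'] [RingHomClass F S S']
    (φ : F) (A : Matrix m n S) (i : ℕ) :
    (determinantalIdeal A i).map φ = determinantalIdeal (A.map φ) i := by
  have map_minor (r : Fin i ↪ m) (c : Fin i ↪ n) :
      φ (A.submatrix r c).det = ((A.map φ).submatrix r c).det :=
    RingHom.map_det (φ : S →+* S') _
  rw [determinantalIdeal, Ideal.map_span, determinantalIdeal]
  congr 1
  ext p
  constructor
  · rintro ⟨_, ⟨r, c, rfl⟩, rfl⟩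
    exact ⟨r, c, map_minor r c⟩
  · rintro ⟨r, c, rfl⟩
    exact ⟨_, ⟨r, c, rfl⟩, map_minor r c⟩

theorem determinantalIdeal_le_delete_row (A : Matrix m n S) (v : m) (i : ℕ) :
    determinantalIdeal A i ≤
      determinantalIdeal (A.submatrix (Subtype.val : {u // u ≠ v} → m) id) (i - 1) := by
  rcases i with _ | i
  · simp only [zero_tsub, determinantalIdeal_zero, le_refl]
  refine determinantalIdeal_le_iff.mpr fun r c => ?_
  obtain ⟨s, hs⟩ : ∃ s, ∀ a, a ≠ s → r a ≠ v := by
    by_cases h : ∃ s, r s = v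
    · obtain ⟨s, rfl⟩ := h
      exact ⟨s, fun a ha => r.injective.ne ha⟩
    · exact ⟨0, fun a _ hav => h ⟨a, hav⟩⟩
  rw [Matrix.det_succ_row _ s]
  refine sum_mem fun j _ => Ideal.mul_mem_left _ _ ?_
  simpa [Function.comp_def] using
    det_submatrix_mem_determinantalIdeal (A.submatrix (Subtype.val : {u // u ≠ v} → m) id)
      (fun a : Fin i => ⟨r (s.succAbove a), hs _ (Fin.succAbove_ne s a)⟩) (c ∘ j.succAbove)

theorem determinantalIdeal_le_delete_row_col (A : Matrix m m S) (v : m) (i : ℕ) :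
    determinantalIdeal A i ≤
      determinantalIdeal (A.submatrix (Subtype.val : {u // u ≠ v} → m)
        (Subtype.val : {u // u ≠ v} → m)) (i - 2) :=
  calc determinantalIdeal A i
    _ ≤ determinantalIdeal (A.submatrix (Subtype.val : {u // u ≠ v} → m) id) (i - 1) :=
      determinantalIdeal_le_delete_row A v i
    _ ≤ determinantalIdeal (A.submatrix (Subtype.val : {u // u ≠ v} → m) id).transpose (i - 1) :=
      determinantalIdeal_transpose_le (A.submatrix Subtype.val id).transpose (i - 1)
    _ ≤ determinantalIdeal (A.submatrix (Subtype.val : {u // u ≠ v} → m)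
        (Subtype.val : {u // u ≠ v} → m)).transpose (i - 2) :=
      determinantalIdeal_le_delete_row _ v (i - 1)
    _ ≤ _ := determinantalIdeal_transpose_le _ (i - 2)

theorem determinantalIdeal_le_delete_rows (A : Matrix m n S) (T : Finset m) (i : ℕ) :
    determinantalIdeal A i ≤
      determinantalIdeal (A.submatrix (Subtype.val : {u // u ∉ T} → m) id) (i - T.card) := by
  classical
  induction T using Finset.induction_on with
  | empty =>
    exact determinantalIdeal_submatrix_le (A.submatrix (Subtype.val : {u // u ∉ ∅} → m) id)
      (fun u => ⟨u, Finset.notMem_empty u⟩) id i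
  | insert v T hv ih =>
    let f (u : {w : {u // u ∉ T} // w ≠ ⟨v, hv⟩}) : {u // u ∉ insert v T} :=
      ⟨u.1, Finset.mem_insert.not.mpr (not_or.mpr ⟨fun h => u.2 (Subtype.ext h), u.1.2⟩)⟩
    rw [Finset.card_insert_of_notMem hv, ← Nat.sub_sub]
    have hf : (A.submatrix (Subtype.val : {u // u ∉ T} → m) id).submatrix
        (Subtype.val : {w // w ≠ ⟨v, hv⟩} → {u // u ∉ T}) id =
        (A.submatrix (Subtype.val : {u // u ∉ insert v T} → m) id).submatrix f id := rfl
    refine ih.trans ((determinantalIdeal_le_delete_row _ ⟨v, hv⟩ _).trans ?_)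
    rw [hf]
    exact determinantalIdeal_submatrix_le _ f id _

end DeterminantalIdeal

section RowExpansion

variable {ι S : Type*} [Fintype ι] [DecidableEq ι] [CommRing S]

theorem det_ite_smul_add (s : Finset ι) (y : ι → S) (A B : Matrix ι ι S) :
    (Matrix.of fun i => if i ∈ s then y i • A i + B i else B i).det =
      ∑ T ∈ s.powerset, (∏ i ∈ T, y i) * (Matrix.of fun i => if i ∈ T then A i else B i).det := by
  let D := (Matrix.detRowAlternating (R := S) (n := ι)).toMultilinearMap
  refine (D.map_piecewise_add (fun i => y i • A i) B s).trans
    (Finset.sum_congr rfl fun T _ => ?_)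
  have hT : T.piecewise (fun i => y i • A i) B =
      T.piecewise (fun i => y i • T.piecewise A B i) (T.piecewise A B) := by
    funext i
    by_cases hi : i ∈ T
    · simp only [Finset.piecewise, if_pos hi]
    · simp only [Finset.piecewise, if_neg hi]
  rw [hT]
  exact D.map_piecewise_smul y (T.piecewise A B) T

theorem det_ite_mem_determinantalIdeal {m n : Type*} (N : Matrix m n S) (r : ι → m)
    (c : ι → n) (T : Finset ι) (A : Matrix ι ι S) :
    (Matrix.of fun i => if i ∈ T then A i else N.submatrix r c i).det ∈
      determinantalIdeal N (Fintype.card ι - T.card) := by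
  set M := Matrix.of fun i => if i ∈ T then A i else N.submatrix r c i
  have hrows : M.submatrix (Subtype.val : {i // i ∉ T} → ι) id =
      N.submatrix (r ∘ Subtype.val) c := by
    ext i j
    simp [M, i.2]
  refine determinantalIdeal_submatrix_le N (r ∘ (Subtype.val : {i // i ∉ T} → ι)) c _ ?_
  rw [← hrows]
  exact determinantalIdeal_le_delete_rows M T _ (det_submatrix_mem_determinantalIdeal M id id)

theorem det_ite_one_submatrix_sumElim {κ m : Type*} [Fintype κ] [DecidableEq κ] [DecidableEq m]
    {w : ι → m} (hw : Function.Injective w) (r : κ → m) {c : κ → m} (hwc : ∀ i j, w i ≠ c j)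
    (B : Matrix (ι ⊕ κ) (ι ⊕ κ) S) :
    (Matrix.of fun i => if i ∈ Finset.univ.map (Function.Embedding.inl : ι ↪ ι ⊕ κ) then
      (1 : Matrix m m S).submatrix (Sum.elim w r) (Sum.elim w c) i else B i).det =
      B.toBlocks₂₂.det := by
  rw [← one_mul B.toBlocks₂₂.det, ← Matrix.det_one (n := ι),
    ← Matrix.det_fromBlocks_zero₁₂ _ B.toBlocks₂₁]
  congr 1
  ext (i | i) (j | j)
  · simp [Matrix.one_apply, hw.eq_iff]
  · simp [Matrix.one_apply, hwc]
  · simp [Matrix.toBlocks₂₁]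
  · simp [Matrix.toBlocks₂₂]

end RowExpansion

theorem span_mul_map_eq_iSup {A B ι : Type*} [CommRing A] [CommRing B] (φ : A →+* B)
    (s : Set ι) (P : ι → Set B) (I : ι → Ideal A) :
    Ideal.span {q | ∃ l ∈ s, ∃ p ∈ P l, ∃ f ∈ I l, q = p * φ f} =
      ⨆ l ∈ s, Ideal.span (P l) * (I l).map φ := by
  refine le_antisymm (Ideal.span_le.mpr ?_) (iSup₂_le fun l hl => ?_)
  · rintro _ ⟨l, hl, p, hp, f, hf, rfl⟩
    exact le_iSup₂ (f := fun l _ => Ideal.span (P l) * (I l).map φ) l hl <|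
      Ideal.mul_mem_mul (Ideal.subset_span hp) (Ideal.mem_map_of_mem φ hf)
  · rw [Ideal.map, Ideal.span_mul_span']
    refine Ideal.span_mono ?_
    rintro _ ⟨p, hp, _, ⟨f, hf, rfl⟩, rfl⟩
    exact ⟨l, hl, p, hp, f, hf, rfl⟩

section Twins

variable {V : Type*} (v : V) (K : ℕ)

/-- The map of the vertices of `d^K(G, v)` onto those of `G` that sends every copy of `v` to `v`;
`G.duplicate v K` is the pull-back of `G` along it. -/
def collapse : V ⊕ Fin K → V := Sum.elim id fun _ => v

variable {v K} in
theorem collapse_eq_of_ne {p q : V ⊕ Fin K} (hpq : p ≠ q)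
    (h : collapse v K p = collapse v K q) : collapse v K q = v := by
  rcases p with u | s
  · rcases q with w | t
    · exact absurd (congrArg Sum.inl h) hpq
    · rfl
  · exact h.symm

theorem twin_injective : Function.Injective (twin v K) := by
  intro s t
  cases s using Fin.cases <;> cases t using Fin.cases <;> simp [twin]

theorem collapse_twin (t : Fin (K + 1)) : collapse v K (twin v K t) = v := by
  cases t using Fin.cases <;> rfl

theorem range_twin : Set.range (twin v K) = {w | collapse v K w = v} := by
  ext w
  constructor
  · rintro ⟨t, rfl⟩
    exact collapse_twin v K t
  · rcases w with u | s
    · exact fun hu => ⟨0, congrArg Sum.inl (Eq.symm hu)⟩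
    · exact fun _ => ⟨s.succ, rfl⟩

section LiftTwin

variable [DecidableEq V]

/-- The section of `collapse v K` that represents `v` by its copy `v^t`. -/
def liftTwin (t : Fin (K + 1)) (u : V) : V ⊕ Fin K := if u = v then twin v K t else Sum.inl u

theorem collapse_liftTwin (t : Fin (K + 1)) (u : V) : collapse v K (liftTwin v K t u) = u := by
  by_cases hu : u = v
  · rw [liftTwin, if_pos hu, collapse_twin, hu]
  · rw [liftTwin, if_neg hu]
    rfl

variable {v K} in
theorem liftTwin_eq_twin {t s : Fin (K + 1)} {u : V} (h : liftTwin v K t u = twin v K s) :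
    t = s := by
  have hu : u = v := by rw [← collapse_liftTwin v K t u, h, collapse_twin]
  rw [liftTwin, if_pos hu] at h
  exact twin_injective v K h

end LiftTwin

variable (R : Type*) [CommRing R]

/-- The ideal generated by `P_l^K(v)`. -/
noncomputable def twinIdeal (l : ℕ) : Ideal (MvPolynomial (V ⊕ Fin K) R) :=
  Ideal.span (twinProducts R v K l)

variable {v K} in
theorem prod_X_mem_twinIdeal {ι : Type*} {T : Finset ι} {r : ι → V ⊕ Fin K} (hr : Set.InjOn r T)
    (h : ∀ i ∈ T, collapse v K (r i) = v) : ∏ i ∈ T, X (r i) ∈ twinIdeal v K R T.card := by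
  classical
  have hT : (T.image r : Set (V ⊕ Fin K)) ⊆ twin v K '' Set.univ := by
    rw [Set.image_univ, range_twin, Finset.coe_image]
    exact Set.image_subset_iff.mpr h
  obtain ⟨C, -, hC⟩ := Finset.subset_set_image_iff.mp hT
  refine Ideal.subset_span ⟨C, ?_, ?_⟩
  · rw [← Finset.card_image_of_injective C (twin_injective v K), hC,
      Finset.card_image_of_injOn hr]
  · rw [← Finset.prod_image hr (f := X), ← hC, Finset.prod_image (twin_injective v K).injOn]

variable {v K R} in
theorem twinIdeal_mul_determinantalIdeal_le_iff {m n : Type*}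
    {A : Matrix m n (MvPolynomial (V ⊕ Fin K) R)} {l i : ℕ}
    {J : Ideal (MvPolynomial (V ⊕ Fin K) R)} :
    twinIdeal v K R l * determinantalIdeal A i ≤ J ↔
      ∀ C : Finset (Fin (K + 1)), C.card = l → ∀ (r : Fin i ↪ m) (c : Fin i ↪ n),
        (∏ t : C, X (twin v K t)) * (A.submatrix r c).det ∈ J := by
  rw [twinIdeal, determinantalIdeal, Ideal.span_mul_span', Ideal.span_le]
  constructor
  · intro h C hC r c
    exact h (Set.mul_mem_mul ⟨C, hC, Finset.prod_coe_sort C fun t => X (twin v K t)⟩ ⟨r, c, rfl⟩)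
  · rintro h _ ⟨_, ⟨C, hC, rfl⟩, _, ⟨r, c, rfl⟩, rfl⟩
    rw [← Finset.prod_coe_sort]
    exact h C hC r c

theorem twinIdeal_antitone : Antitone (twinIdeal v K R) := by
  intro k l hkl
  refine Ideal.span_le.mpr ?_
  rintro _ ⟨C, rfl, rfl⟩
  obtain ⟨D, hDC, hD⟩ := Finset.exists_subset_card_eq hkl
  rw [← Finset.prod_sdiff hDC]
  exact Ideal.mul_mem_left _ _ (Ideal.subset_span ⟨D, hD, rfl⟩)

end Twins

namespace SignedMultidigraph

variable {V : Type*} [DecidableEq V] (R : Type*) [CommRing R] (G : SignedMultidigraph V)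

theorem criticalIdeal_eq_determinantalIdeal (i : ℕ) :
    G.criticalIdeal R i = determinantalIdeal (G.laplacian R) i := rfl

section Corank

theorem criticalIdeal_corank [Fintype V] : G.criticalIdeal R (G.corank R) = ⊤ := by
  classical
  unfold corank
  exact Nat.findGreatest_spec (P := fun i => G.criticalIdeal R i = ⊤) (Nat.zero_le _)
    (determinantalIdeal_zero _)

theorem corank_le_card [Fintype V] : G.corank R ≤ Fintype.card V :=
  Nat.findGreatest_le _

variable {R G} in
theorem le_corank [Fintype V] {i : ℕ} (hi : i ≤ Fintype.card V) (h : G.criticalIdeal R i = ⊤) :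
    i ≤ G.corank R := by
  classical
  exact Nat.le_findGreatest hi h

end Corank

section Comap

variable {W : Type*} [DecidableEq W] {h : W → V} (hh : Function.Injective h)
include hh

theorem laplacian_comap_map_rename :
    ((G.comap h).laplacian R).map (rename h) = (G.laplacian R).submatrix h h := by
  ext1 p q
  by_cases hpq : p = q
  · subst hpq
    simp [laplacian]
  · simp [laplacian, comap, hpq, hh.eq_iff]

theorem laplacian_map_killCompl_submatrix :
    ((G.laplacian R).map (killCompl hh)).submatrix h h = (G.comap h).laplacian R := by
  rw [Matrix.submatrix_map, ← laplacian_comap_map_rename R G hh]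
  ext1 p q
  exact killCompl_rename_app hh _

theorem map_rename_criticalIdeal_comap_le (i : ℕ) :
    ((G.comap h).criticalIdeal R i).map (rename h) ≤ G.criticalIdeal R i := by
  rw [criticalIdeal_eq_determinantalIdeal, map_determinantalIdeal,
    laplacian_comap_map_rename R G hh]
  exact determinantalIdeal_submatrix_le _ h h i

theorem corank_comap_le [Fintype V] [Fintype W] : (G.comap h).corank R ≤ G.corank R := by
  refine le_corank ((corank_le_card R _).trans (Fintype.card_le_of_injective h hh)) ?_
  have hle := map_rename_criticalIdeal_comap_le R G hh ((G.comap h).corank R)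
  rwa [criticalIdeal_corank, Ideal.map_top, top_le_iff] at hle

end Comap

section Duplicate

variable (v : V) (K : ℕ)

/-- The evaluation `f ↦ f|_{x_v = 0}` with values in the polynomial ring of `d^K(G, v)`. -/
noncomputable def evalZeroRename : MvPolynomial V R →ₐ[R] MvPolynomial (V ⊕ Fin K) R :=
  (rename Sum.inl).comp (evalZero R v)

/-- The matrix `L(G, X)|_{x_v = 0}` over the polynomial ring of `d^K(G, v)`. -/
noncomputable def zeroedLaplacian : Matrix V V (MvPolynomial (V ⊕ Fin K) R) :=
  (G.laplacian R).map (evalZeroRename R v K)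

theorem evalZero_eq_rename_comp_killCompl :
    evalZero R v = (rename Subtype.val).comp
      (killCompl (Subtype.val_injective (p := fun u => u ≠ v))) := by
  ext1 u
  by_cases hu : u = v
  · simp [evalZero, killCompl, hu]
  · have hX : (X u : MvPolynomial V R) =
        rename Subtype.val (X (⟨u, hu⟩ : {u // u ≠ v})) := by rw [rename_X]
    rw [AlgHom.comp_apply, hX, killCompl_rename_app]
    simp [evalZero, hu]

theorem evalZeroRename_eq_rename_comp_killCompl :
    evalZeroRename R v K = (rename (Sum.inl ∘ Subtype.val)).comp
      (killCompl (Subtype.val_injective (p := fun u => u ≠ v))) := by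
  rw [evalZeroRename, evalZero_eq_rename_comp_killCompl, ← AlgHom.comp_assoc, rename_comp_rename]

theorem map_evalZeroRename_criticalIdeal (i : ℕ) :
    (G.criticalIdeal R i).map (evalZeroRename R v K) =
      determinantalIdeal (G.zeroedLaplacian R v K) i :=
  map_determinantalIdeal _ _ _

theorem zeroedLaplacian_submatrix_val :
    (G.zeroedLaplacian R v K).submatrix (Subtype.val : {u // u ≠ v} → V) Subtype.val =
      ((G.deleteVertex v).laplacian R).map (rename (Sum.inl ∘ Subtype.val)) := by
  rw [deleteVertex, ← laplacian_map_killCompl_submatrix R G Subtype.val_injective, zeroedLaplacian,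
    evalZeroRename_eq_rename_comp_killCompl]
  rfl

theorem laplacian_duplicate_apply (p q : V ⊕ Fin K) :
    (G.duplicate v K).laplacian R p q = (if p = q ∧ collapse v K p = v then X p else 0) +
      G.zeroedLaplacian R v K (collapse v K p) (collapse v K q) := by
  by_cases hpq : p = q
  · subst hpq
    by_cases hp : collapse v K p = v
    · simp [laplacian, zeroedLaplacian, evalZeroRename, evalZero, hp]
    · rcases p with u | s
      · have hu : u ≠ v := hp
        simp [laplacian, zeroedLaplacian, evalZeroRename, evalZero, collapse, hu]
      · exact absurd rfl hp
  · have hmult : (G.duplicate v K).mult p q = G.mult (collapse v K p) (collapse v K q) := rfl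
    have hsign : (G.duplicate v K).sign p q = G.sign (collapse v K p) (collapse v K q) := rfl
    by_cases hc : collapse v K p = collapse v K q
    · have hq := collapse_eq_of_ne hpq hc
      simp [laplacian, zeroedLaplacian, evalZeroRename, evalZero, hpq, hmult, hc, hq, G.loopless]
    · simp [laplacian, zeroedLaplacian, evalZeroRename, evalZero, hpq, hmult, hsign, hc]

section Corank

variable {R G v K}

theorem map_killCompl_criticalIdeal_eq_top {i : ℕ} (h : (G.duplicate v K).criticalIdeal R i = ⊤) :
    (G.criticalIdeal R i).map
      (killCompl (Subtype.val_injective (p := fun u => u ≠ v))) = ⊤ := by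
  set κ := killCompl (R := R) (Subtype.val_injective (p := fun u => u ≠ v))
  let ψ : MvPolynomial (V ⊕ Fin K) R →ₐ[R] MvPolynomial {u // u ≠ v} R :=
    κ.comp (rename (collapse v K))
  have hX (p) (hp : collapse v K p = v) : ψ (X p) = 0 := by
    simp [ψ, κ, hp, killCompl]
  have hψ (f) : ψ (evalZeroRename R v K f) = κ f := by
    simp [ψ, evalZeroRename_eq_rename_comp_killCompl, rename_rename, κ,
      show collapse v K ∘ Sum.inl ∘ Subtype.val = (Subtype.val : {u // u ≠ v} → V) from rfl]
  have hmap : ((G.duplicate v K).laplacian R).map ψ =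
      ((G.laplacian R).map κ).submatrix (collapse v K) (collapse v K) := by
    ext1 p q
    rw [Matrix.map_apply, laplacian_duplicate_apply, map_add]
    refine (congrArg₂ (· + ·) ?_ (hψ _)).trans (zero_add _)
    split_ifs with hp
    · exact hX p hp.2
    · exact map_zero ψ
  rw [criticalIdeal_eq_determinantalIdeal, map_determinantalIdeal, eq_top_iff]
  refine le_trans ?_ (determinantalIdeal_submatrix_le _ (collapse v K) (collapse v K) i)
  rw [← hmap, ← map_determinantalIdeal, ← criticalIdeal_eq_determinantalIdeal, h, Ideal.map_top]

theorem determinantalIdeal_zeroedLaplacian_eq_top {i K' : ℕ}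
    (h : (G.duplicate v K').criticalIdeal R i = ⊤) :
    determinantalIdeal (G.zeroedLaplacian R v K) i = ⊤ := by
  rw [← map_evalZeroRename_criticalIdeal, evalZeroRename_eq_rename_comp_killCompl,
    ← Ideal.map_mapₐ, map_killCompl_criticalIdeal_eq_top h, Ideal.map_top]

theorem criticalIdeal_deleteVertex_sub_two_eq_top {i : ℕ}
    (h : (G.duplicate v K).criticalIdeal R i = ⊤) :
    (G.deleteVertex v).criticalIdeal R (i - 2) = ⊤ := by
  have htop := map_killCompl_criticalIdeal_eq_top h
  rw [criticalIdeal_eq_determinantalIdeal, map_determinantalIdeal] at htop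
  rw [eq_top_iff, ← htop, criticalIdeal_eq_determinantalIdeal, deleteVertex,
    ← laplacian_map_killCompl_submatrix R G Subtype.val_injective]
  exact determinantalIdeal_le_delete_row_col _ v i

variable (R G v K)

theorem corank_deleteVertex_le [Fintype V] :
    (G.deleteVertex v).corank R ≤ (G.duplicate v K).corank R :=
  corank_comap_le R (G.duplicate v K) (Sum.inl_injective.comp Subtype.val_injective)

theorem corank_duplicate_one_le [Fintype V] :
    (G.duplicate v 1).corank R ≤ (G.deleteVertex v).corank R + 2 := by
  have hcard : (G.duplicate v 1).corank R ≤ Fintype.card V + 1 := by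
    simpa using corank_le_card R (G.duplicate v 1)
  have hcard' : Fintype.card {u // u ≠ v} = Fintype.card V - 1 := by simp
  have := le_corank (i := (G.duplicate v 1).corank R - 2) (by omega)
    (criticalIdeal_deleteVertex_sub_two_eq_top (criticalIdeal_corank R (G.duplicate v 1)))
  omega

end Corank

section MinorExpansion

variable {R G v K} {ι : Type*} [Fintype ι] [DecidableEq ι]

theorem det_laplacian_duplicate_submatrix (r c : ι → V ⊕ Fin K) (s : Finset ι)
    (hs : ∀ i ∈ s, collapse v K (r i) = v)
    (hrc : ∀ i ∉ s, ∀ j, collapse v K (r i) = v → r i ≠ c j) :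
    (((G.duplicate v K).laplacian R).submatrix r c).det =
      ∑ T ∈ s.powerset, (∏ i ∈ T, X (r i)) *
        (Matrix.of fun i => if i ∈ T then (1 : Matrix _ _ _).submatrix r c i else
          (G.zeroedLaplacian R v K).submatrix (collapse v K ∘ r) (collapse v K ∘ c) i).det := by
  rw [← det_ite_smul_add s]
  congr 1
  ext1 i j
  rw [Matrix.submatrix_apply, laplacian_duplicate_apply]
  by_cases hi : i ∈ s
  · simp [hi, hs i hi, Matrix.one_apply]
  · have hij : ¬ (r i = c j ∧ collapse v K (r i) = v) := fun h => hrc i hi j h.2 h.1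
    simp [hi, hij]

theorem prod_X_mul_det_ite_mem (r c : ι → V ⊕ Fin K) {T : Finset ι} (hr : Set.InjOn r T)
    (hT : ∀ i ∈ T, collapse v K (r i) = v)
    (A : Matrix ι ι (MvPolynomial (V ⊕ Fin K) R)) :
    (∏ i ∈ T, X (r i)) * (Matrix.of fun i => if i ∈ T then A i else
        (G.zeroedLaplacian R v K).submatrix (collapse v K ∘ r) (collapse v K ∘ c) i).det ∈
      twinIdeal v K R T.card *
        determinantalIdeal (G.zeroedLaplacian R v K) (Fintype.card ι - T.card) :=
  Ideal.mul_mem_mul (prod_X_mem_twinIdeal R hr hT) (det_ite_mem_determinantalIdeal _ _ _ T A)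

end MinorExpansion

theorem criticalIdeal_duplicate_le_iSup (j : ℕ) :
    (G.duplicate v K).criticalIdeal R j ≤
      ⨆ l, twinIdeal v K R l * determinantalIdeal (G.zeroedLaplacian R v K) (j - l) := by
  refine determinantalIdeal_le_iff.mpr fun r c => ?_
  rw [det_laplacian_duplicate_submatrix r c {i | collapse v K (r i) = v} (by simp)
    (fun i hi _ h => absurd h (by simpa using hi))]
  refine sum_mem fun T hT => ?_
  have htwin : ∀ i ∈ T, collapse v K (r i) = v := fun i hi => by
    simpa using Finset.mem_powerset.mp hT hi
  have hterm := prod_X_mul_det_ite_mem (G := G) (R := R) r c r.injective.injOn htwin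
    ((1 : Matrix _ _ _).submatrix r c)
  rw [Fintype.card_fin] at hterm
  exact le_iSup (fun l => twinIdeal v K R l *
    determinantalIdeal (G.zeroedLaplacian R v K) (j - l)) T.card hterm

variable {R G v K}

/-- The condition `hr` keeps the variables of the copies out of the bordered block. -/
theorem prod_X_mul_det_mem_of_border {ι κ : Type*} [Fintype ι] [Fintype κ] [DecidableEq κ]
    (w : ι ↪ V ⊕ Fin K) (r c : κ → V ⊕ Fin K) (hw : ∀ t, collapse v K (w t) = v)
    (hr : ∀ i j, collapse v K (r i) = v → r i ≠ c j) (hwr : ∀ t i, w t ≠ r i)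
    (hwc : ∀ t j, w t ≠ c j) {j : ℕ} (hj : Fintype.card ι + Fintype.card κ = j)
    (hlow : ∀ l < Fintype.card ι,
      twinIdeal v K R l * determinantalIdeal (G.zeroedLaplacian R v K) (j - l) ≤
        (G.duplicate v K).criticalIdeal R j) :
    (∏ t, X (w t)) *
      ((G.zeroedLaplacian R v K).submatrix (collapse v K ∘ r) (collapse v K ∘ c)).det ∈
        (G.duplicate v K).criticalIdeal R j := by
  classical
  let s : Finset (ι ⊕ κ) := Finset.univ.map Function.Embedding.inl
  have hscard : s.card = Fintype.card ι := Finset.card_map _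
  have hrs : ∀ i ∈ s, collapse v K (Sum.elim w r i) = v := by simp [s, hw]
  have hinj : Set.InjOn (Sum.elim w r) s := by simp [s, Set.InjOn]
  have hrc : ∀ i ∉ s, ∀ j, collapse v K (Sum.elim w r i) = v →
      Sum.elim w r i ≠ Sum.elim w c j := by
    rintro (t | i) hi (u | j) h
    · simp [s] at hi
    · simp [s] at hi
    · exact (hwr u i).symm
    · exact hr i j h
  have hcard : Fintype.card (ι ⊕ κ) = j := Fintype.card_sum.trans hj
  have hdet := det_submatrix_mem_determinantalIdeal ((G.duplicate v K).laplacian R)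
    (Sum.elim w r) (Sum.elim w c)
  rw [hcard, det_laplacian_duplicate_submatrix _ _ s hrs hrc,
    ← Finset.add_sum_erase _ _ (Finset.mem_powerset_self s)] at hdet
  have hlead := (Ideal.add_mem_iff_left _ (sum_mem fun T hT => ?_)).mp hdet
  · rwa [Finset.prod_map, det_ite_one_submatrix_sumElim w.injective r hwc] at hlead
  · obtain ⟨hne, hTs⟩ := Finset.mem_erase.mp hT
    have hTs := Finset.mem_powerset.mp hTs
    have hlt := Finset.card_lt_card (hTs.ssubset_of_ne hne)
    refine hlow T.card (hscard ▸ hlt) ?_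
    rw [← hcard]
    exact prod_X_mul_det_ite_mem _ _ (hinj.mono hTs) (fun i hi => hrs i (hTs hi)) _

theorem twinIdeal_mul_determinantalIdeal_le {l j : ℕ} (hlK : l < K) (hlj : l ≤ j) :
    twinIdeal v K R l * determinantalIdeal (G.zeroedLaplacian R v K) (j - l) ≤
      (G.duplicate v K).criticalIdeal R j := by
  induction l using Nat.strong_induction_on with | _ l ih
  refine twinIdeal_mul_determinantalIdeal_le_iff.mpr fun C hC r c => ?_
  obtain ⟨s, hs, t, ht, hst⟩ : ∃ s ∈ Cᶜ, ∃ t ∈ Cᶜ, s ≠ t := by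
    refine Finset.one_lt_card.mp ?_
    rw [Finset.card_compl, Fintype.card_fin, hC]
    omega
  rw [Finset.mem_compl] at hs ht
  have hlift (s : Fin (K + 1)) {a : ℕ} (f : Fin a → V) : collapse v K ∘ liftTwin v K s ∘ f = f :=
    funext fun i => collapse_liftTwin v K s (f i)
  have twin_ne_liftTwin {s} (hs : s ∉ C) (x : C) (u : V) : twin v K x ≠ liftTwin v K s u :=
    fun h => hs (liftTwin_eq_twin h.symm ▸ x.2)
  have hmem := prod_X_mul_det_mem_of_border (G := G) (R := R) (j := j)
    ((Function.Embedding.subtype (· ∈ C)).trans ⟨twin v K, twin_injective v K⟩)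
    (liftTwin v K s ∘ r) (liftTwin v K t ∘ c) (fun x => collapse_twin v K x)
    (fun i i' h => ?_) (fun x i => twin_ne_liftTwin hs x (r i))
    (fun x i => twin_ne_liftTwin ht x (c i)) (by simp [hC, hlj]) ?_
  · rwa [hlift, hlift] at hmem
  · have hri : r i = v := by rwa [Function.comp_apply, collapse_liftTwin] at h
    rw [Function.comp_apply, hri, liftTwin, if_pos rfl]
    exact fun h => hst (liftTwin_eq_twin h.symm).symm
  · rw [Fintype.card_coe, hC]
    exact fun l' hl' => ih l' hl' (hl'.trans hlK) (hl'.le.trans hlj)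

theorem twinIdeal_mul_determinantalIdeal_deleteVertex_le {l j : ℕ} (hlK : l ≤ K) (hlj : l ≤ j) :
    twinIdeal v K R l * determinantalIdeal ((G.zeroedLaplacian R v K).submatrix
      (Subtype.val : {u // u ≠ v} → V) (Subtype.val : {u // u ≠ v} → V)) (j - l) ≤
      (G.duplicate v K).criticalIdeal R j := by
  refine twinIdeal_mul_determinantalIdeal_le_iff.mpr fun C hC r c => ?_
  have twin_ne_inl (t : Fin (K + 1)) (u : {u // u ≠ v}) : twin v K t ≠ Sum.inl u.1 :=
    fun h => u.2 ((congrArg (collapse v K) h).symm.trans (collapse_twin v K t))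
  refine prod_X_mul_det_mem_of_border (j := j)
    ((Function.Embedding.subtype (· ∈ C)).trans ⟨twin v K, twin_injective v K⟩)
    (Sum.inl ∘ Subtype.val ∘ r) (Sum.inl ∘ Subtype.val ∘ c) (fun x => collapse_twin v K x)
    (fun i _ h => absurd h (r i).2) (fun x i => twin_ne_inl x (r i))
    (fun x i => twin_ne_inl x (c i)) (by simp [hC, hlj]) ?_
  rw [Fintype.card_coe, hC]
  exact fun l' hl' => twinIdeal_mul_determinantalIdeal_le (hl'.trans_le hlK) (hl'.le.trans hlj)

theorem criticalIdeal_duplicate_eq_iSup {d k : ℕ} (hkK : k ≤ K)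
    (hd : determinantalIdeal (G.zeroedLaplacian R v K) d = ⊤)
    (hdel : k = K → (G.deleteVertex v).criticalIdeal R d = ⊤) :
    (G.duplicate v K).criticalIdeal R (d + k) =
      ⨆ l ∈ Set.Iic k, twinIdeal v K R l * (G.criticalIdeal R (d + k - l)).map
        (evalZeroRename R v K) := by
  simp only [map_evalZeroRename_criticalIdeal]
  let term (l : ℕ) := twinIdeal v K R l *
    determinantalIdeal (G.zeroedLaplacian R v K) (d + k - l)
  have hterm {l} (hl : l ≤ k) : term l ≤ ⨆ l ∈ Set.Iic k, term l :=
    le_iSup₂ (f := fun l _ => term l) l hl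
  have htop : term k = twinIdeal v K R k := by
    simp only [term, Nat.add_sub_cancel, hd, Ideal.mul_top]
  refine le_antisymm ((criticalIdeal_duplicate_le_iSup R G v K _).trans (iSup_le fun l => ?_))
    (iSup₂_le fun l hl => ?_)
  · rcases le_total l k with hl | hl
    · exact hterm hl
    · calc term l
        _ ≤ twinIdeal v K R l := Ideal.mul_le_left
        _ ≤ twinIdeal v K R k := twinIdeal_antitone v K R hl
        _ = term k := htop.symm
        _ ≤ _ := hterm le_rfl
  · have hlk : l ≤ k := hl
    rcases (hlk.trans hkK).lt_or_eq with hlK | rfl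
    · exact twinIdeal_mul_determinantalIdeal_le hlK (by omega)
    · obtain rfl : l = k := le_antisymm hlk hkK
      have hle := twinIdeal_mul_determinantalIdeal_deleteVertex_le (G := G) (R := R) (v := v)
        le_rfl (Nat.le_add_left l d)
      rw [Nat.add_sub_cancel, zeroedLaplacian_submatrix_val, ← map_determinantalIdeal,
        ← criticalIdeal_eq_determinantalIdeal, hdel rfl, Ideal.map_top, Ideal.mul_top] at hle
      exact htop.le.trans hle

end Duplicate

end SignedMultidigraph

theorem mainTheorem3_general {V : Type*} [Fintype V] [DecidableEq V] (R : Type*) [CommRing R]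
    (G : SignedMultidigraph V) (v : V) (γd γv lam : ℕ)
    (hγd : γd = (G.duplicate v 1).corank R) (hγv : γv = (G.deleteVertex v).corank R)
    (hlam : lam = regularityConst γv γd) :
    (0 ≤ (γd : ℤ) - (γv : ℤ) ∧ (γd : ℤ) - (γv : ℤ) ≤ 2) ∧
    ∀ k i : ℕ,
      (G.duplicate v (k + lam + i)).criticalIdeal R (γd + k) =
        Ideal.span {q | ∃ l ≤ k, ∃ p ∈ twinProducts R v (k + lam + i) l,
          ∃ f ∈ G.criticalIdeal R (γd + k - l),
            q = p * MvPolynomial.rename Sum.inl (evalZero R v f)} := by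
  subst hγd hγv
  refine ⟨?_, fun k i => ?_⟩
  · have hle := G.corank_deleteVertex_le R v 1
    have hle_add := G.corank_duplicate_one_le R v
    omega
  · have hspan := span_mul_map_eq_iSup (SignedMultidigraph.evalZeroRename R v _).toRingHom
      (Set.Iic k) (twinProducts R v (k + lam + i))
      fun l => G.criticalIdeal R ((G.duplicate v 1).corank R + k - l)
    refine Eq.trans ?_ hspan.symm
    refine SignedMultidigraph.criticalIdeal_duplicate_eq_iSup (by omega)
      (SignedMultidigraph.determinantalIdeal_zeroedLaplacian_eq_top
        ((G.duplicate v 1).criticalIdeal_corank R)) fun hK => ?_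
    have hcorank : (G.deleteVertex v).corank R = (G.duplicate v 1).corank R := by
      by_contra hne
      rw [regularityConst, if_neg hne] at hlam
      omega
    rw [← hcorank, SignedMultidigraph.criticalIdeal_corank]

theorem mainTheorem3 {V : Type*} [Fintype V] [DecidableEq V] (R : Type*) [CommRing R]
    [Nontrivial R] (G : SignedMultidigraph V) (v : V) (γd γv lam : ℕ)
    (hγd : γd = (G.duplicate v 1).corank R) (hγv : γv = (G.deleteVertex v).corank R)
    (hlam : lam = regularityConst γv γd) (hG : 2 ≤ G.corank R) :
    (0 ≤ (γd : ℤ) - (γv : ℤ) ∧ (γd : ℤ) - (γv : ℤ) ≤ 2) ∧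
    ∀ k i : ℕ, 1 ≤ k →
      (G.duplicate v (k + lam + i)).criticalIdeal R (γd + k) =
        Ideal.span {q | ∃ l ≤ k, ∃ p ∈ twinProducts R v (k + lam + i) l,
          ∃ f ∈ G.criticalIdeal R (γd + k - l),
            q = p * MvPolynomial.rename Sum.inl (evalZero R v f)} := by
  obtain ⟨hbounds, hideal⟩ := mainTheorem3_general R G v γd γv lam hγd hγv hlam
  exact ⟨hbounds, fun k i _ => hideal k i⟩
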